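/- Let $n \ge 4$. In the biased clique game $\mathrm{Clique}_{(1,3)}(n)$, two players, Alice (first player) and Bob (second player), alternately colour previously uncoloured edges of the complete graph $K_n$, with Alice starting. In each of her turns Alice colours $1$ edge red, and in each of his turns Bob colours $3$ edges blue (or all remaining uncoloured edges, if fewer than $3$ are left). The game ends when all edges are coloured. Let $A$ and $B$ be the final sets of red and blue edges, and let $a=\omega(G[A])$ and $b=\omega(G[B])$ be the clique numbers of the red and the blue graph. Bob wins if $b>a$. Then, for every $n\ge 4$, the game $\mathrm{Clique}_{(1,3)}(n)$ is won by the second player: Bob has a strategy which guarantees $b>a$ at the end of the game, however Alice plays. -/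

import Mathlib

namespace CliqueGame

variable {V : Type*} [DecidableEq V]

/-- A position of the game: the edges coloured red (by Alice) and blue (by Bob) so far. -/
structure Position (V : Type*) where
  red : Finset (Sym2 V)
  blue : Finset (Sym2 V)

/-- No edge is coloured at the start. -/
def Position.start (V : Type*) : Position V := ⟨∅, ∅⟩

/-- The edges of the board `G` that are not yet coloured. -/
def Position.uncoloured (G : SimpleGraph V) [Fintype G.edgeSet] (P : Position V) :
    Finset (Sym2 V) :=
  G.edgeFinset \ (P.red ∪ P.blue)

/-- Alice colours the edges in `S`. -/
def Position.addRed (P : Position V) (S : Finset (Sym2 V)) : Position V := ⟨P.red ∪ S, P.blue⟩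

/-- Bob colours the edges in `T`. -/
def Position.addBlue (P : Position V) (T : Finset (Sym2 V)) : Position V := ⟨P.red, P.blue ∪ T⟩

/-- `S` is a legal choice for a player who colours `k` edges per turn: exactly `k` uncoloured
edges, or all of them if fewer than `k` are left. -/
def Position.IsMove (G : SimpleGraph V) [Fintype G.edgeSet] (P : Position V) (k : ℕ)
    (S : Finset (Sym2 V)) : Prop :=
  S ⊆ P.uncoloured G ∧ S.card = min k (P.uncoloured G).card

/-- The game is over when every edge of the board is coloured. -/
def Position.IsOver (G : SimpleGraph V) [Fintype G.edgeSet] (P : Position V) : Prop :=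
  P.uncoloured G = ∅

/-- Alice's result: the clique number of the red graph. -/
noncomputable def Position.scoreAlice (P : Position V) : ℕ :=
  (SimpleGraph.fromEdgeSet (P.red : Set (Sym2 V))).cliqueNum

/-- Bob's result: the clique number of the blue graph. -/
noncomputable def Position.scoreBob (P : Position V) : ℕ :=
  (SimpleGraph.fromEdgeSet (P.blue : Set (Sym2 V))).cliqueNum

/-- A strategy of Bob: in each position in which he is to move, the set of edges he colours. -/
abbrev Strategy (V : Type*) := Position V → Finset (Sym2 V)

/-- The positions with Alice to move (or with the game over) that can arise when Alice, who starts
and colours `p` edges per turn, plays arbitrary legal moves and Bob answers by `σ`. -/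
inductive Reachable (G : SimpleGraph V) [Fintype G.edgeSet] (p : ℕ) (σ : Strategy V) :
    Position V → Prop
  | start : Reachable G p σ (Position.start V)
  | round (P : Position V) (S : Finset (Sym2 V)) :
      Reachable G p σ P → ¬ P.IsOver G → P.IsMove G p S →
      Reachable G p σ ((P.addRed S).addBlue (σ (P.addRed S)))

/-- `σ` is a winning strategy for Bob in the `(p, q)`-biased clique game on `G`, where
`1 ≤ p < q`: his answers are always legal, and whenever the game is over his largest clique is
strictly larger than Alice's. (As `1 ≤ p`, at least one edge is coloured in each round, so
every play ends.) -/
structure IsWinningForBob (G : SimpleGraph V) [Fintype G.edgeSet] (p q : ℕ) (σ : Strategy V) :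
    Prop where
  legal : ∀ (P : Position V) (S : Finset (Sym2 V)), Reachable G p σ P → ¬ P.IsOver G →
    P.IsMove G p S → (P.addRed S).IsMove G q (σ (P.addRed S))
  wins : ∀ P : Position V, Reachable G p σ P → P.IsOver G → P.scoreAlice < P.scoreBob

/-- The `(p, q)`-biased clique game on `G` (with `1 ≤ p < q`) is won by the second player. -/
def WonByBob (G : SimpleGraph V) [Fintype G.edgeSet] (p q : ℕ) : Prop :=
  ∃ σ : Strategy V, IsWinningForBob G p q σ

end CliqueGame

/-!
Bob plays with a *conflict graph* on the edges of the board, of maximum degree at most `q`: whenever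
Alice colours `e`, he colours every neighbour of `e`. The red edges are then independent in the
conflict graph, and it remains to find a conflict graph for which every such red graph has an
independent set larger than its largest clique. The conflict graph may depend on Alice's first edge.

Split the vertices into a core of four or five vertices containing Alice's first edge, and pairs
`v, v'`. Between two pairs, all four edges conflict with each other. Thus a red clique containing a
whole pair has no other vertices outside the core, and further conflicts keep it out of the core. If
it meets each pair at most once, its vertices outside the core can be replaced by their partners,
which form a blue clique of the same size. One more vertex is gained inside the core, where Alice's
first edge has been answered by a whole blue triangle. If the red clique avoids the core, the extra
vertex is either a vertex of the clique whose edge to its partner is blue, or a fixed vertex of the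
core, the apex, which conflicts make blue to both ends of every red edge `vv'`.
-/

namespace CliqueGame

section Cliques

variable {V W : Type*}

theorem cliqueNum_le_of_hom [Finite W] {G : SimpleGraph V} {H : SimpleGraph W} (f : G →g H) :
    G.cliqueNum ≤ H.cliqueNum := by
  classical
  obtain ⟨C, hC⟩ := G.exists_isNClique_cliqueNum
  have hinj : Set.InjOn f C := fun x hx y hy hxy =>
    by_contra fun hne => (f.map_adj (hC.isClique hx hy hne)).ne hxy
  have himage : H.IsClique (C.image f : Finset W) := by
    rw [Finset.coe_image]
    rintro _ ⟨x, hx, rfl⟩ _ ⟨y, hy, rfl⟩ hxy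
    exact f.map_adj (hC.isClique hx hy (ne_of_apply_ne f hxy))
  calc G.cliqueNum = (C.image f).card := by rw [Finset.card_image_of_injOn hinj, hC.card_eq]
    _ ≤ H.cliqueNum := himage.card_le_cliqueNum

theorem card_inter_le_one_of_isClique_of_isIndepSet [DecidableEq V] {G : SimpleGraph V}
    {C I : Finset V} (hC : G.IsClique C) (hI : G.IsIndepSet I) : (C ∩ I).card ≤ 1 := by
  refine Finset.card_le_one.2 fun x hx y hy => by_contra fun hxy => ?_
  rw [Finset.mem_inter] at hx hy
  exact hI hx.2 hy.2 hxy (hC hx.1 hy.1 hxy)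

theorem isIndepSet_pair [DecidableEq V] {G : SimpleGraph V} {a b : V} (hab : ¬ G.Adj a b) :
    G.IsIndepSet ({a, b} : Finset V) := by
  rw [Finset.coe_pair]
  exact Set.pairwise_pair.2 fun _ => ⟨hab, fun h => hab h.symm⟩

theorem isIndepSet_triple [DecidableEq V] {G : SimpleGraph V} {a b c : V} (hab : ¬ G.Adj a b)
    (hac : ¬ G.Adj a c) (hbc : ¬ G.Adj b c) : G.IsIndepSet ({a, b, c} : Finset V) := by
  intro x hx y hy hxy
  grind [G.adj_comm]

theorem not_adj_of_isIndepSet_edgeSet {R : SimpleGraph V} {H : SimpleGraph (Sym2 V)}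
    (hR : H.IsIndepSet R.edgeSet) {a b c d : V} (h : H.Adj s(a, b) s(c, d)) (hab : R.Adj a b) :
    ¬ R.Adj c d :=
  fun hcd => hR hab hcd h.ne h

theorem encard_neighborSet_eq_degree (G : SimpleGraph V) (v : V) [Fintype (G.neighborSet v)] :
    (G.neighborSet v).encard = G.degree v := by
  rw [← G.coe_neighborFinset, Set.encard_coe_eq_coe_finsetCard, G.card_neighborFinset_eq_degree]

end Cliques

section Strategies

variable {V : Type*} {G : SimpleGraph V}

/-- The position arises on the board `G` when Bob answers each red edge by colouring all its
neighbours in the graph `H`, whose vertices are the edges of the board. -/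
structure Position.Follows (G : SimpleGraph V) (H : SimpleGraph (Sym2 V)) (P : Position V) :
    Prop where
  red_subset : ∀ e ∈ P.red, e ∈ G.edgeSet
  disjoint : Disjoint P.red P.blue
  mem_blue : ∀ e ∈ P.red, ∀ f ∈ G.edgeSet, H.Adj e f → f ∈ P.blue

theorem Position.Follows.isIndepSet {H : SimpleGraph (Sym2 V)} {P : Position V}
    (hP : P.Follows G H) : H.IsIndepSet (P.red : Set (Sym2 V)) :=
  fun e he f hf _ hadj =>
    Finset.disjoint_left.1 hP.disjoint hf (hP.mem_blue e he f (hP.red_subset f hf) hadj)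

theorem Position.follows_start (H : SimpleGraph (Sym2 V)) : (Position.start V).Follows G H := by
  constructor <;> simp [Position.start]

variable [DecidableEq V] [Fintype G.edgeSet] {p q : ℕ}

theorem wonByBob_of_invariant (I : Position V → Prop) (hstart : I (Position.start V))
    (hstep : ∀ P S, I P → ¬ P.IsOver G → P.IsMove G p S →
      ∃ T, (P.addRed S).IsMove G q T ∧ I ((P.addRed S).addBlue T))
    (hwin : ∀ P, I P → P.IsOver G → P.scoreAlice < P.scoreBob) : WonByBob G p q := by
  let σ : Strategy V := fun Q => Classical.epsilon fun T => Q.IsMove G q T ∧ I (Q.addBlue T)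
  have hσ (P S) (hP : I P) (hover : ¬ P.IsOver G) (hS : P.IsMove G p S) :=
    Classical.epsilon_spec (hstep P S hP hover hS)
  have hI (P) (hP : Reachable G p σ P) : I P := by
    induction hP with
    | start => exact hstart
    | round P S _ hover hS ih => exact (hσ P S ih hover hS).2
  exact ⟨σ, fun P S hP hover hS => (hσ P S (hI P hP) hover hS).1,
    fun P hP hover => hwin P (hI P hP) hover⟩

theorem Position.mem_uncoloured {P : Position V} {e : Sym2 V} :
    e ∈ P.uncoloured G ↔ e ∈ G.edgeSet ∧ e ∉ P.red ∧ e ∉ P.blue := by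
  simp [Position.uncoloured]

theorem Position.sdiff_red_le_blue_of_isOver {P : Position V} (hP : P.IsOver G) :
    G \ SimpleGraph.fromEdgeSet (P.red : Set (Sym2 V)) ≤
      SimpleGraph.fromEdgeSet (P.blue : Set (Sym2 V)) := by
  intro a b ⟨hab, hred⟩
  have hnot : s(a, b) ∉ P.uncoloured G := by
    simp only [show P.uncoloured G = ∅ from hP, Finset.notMem_empty, not_false_iff]
  simp only [SimpleGraph.fromEdgeSet_adj, Finset.mem_coe] at hred ⊢
  grind [Position.mem_uncoloured, SimpleGraph.mem_edgeSet, hab.ne]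

theorem Position.Follows.addRed_addBlue {H : SimpleGraph (Sym2 V)} {P : Position V}
    (hP : P.Follows G H) {e : Sym2 V} (he : e ∈ P.uncoloured G) {T : Finset (Sym2 V)}
    (hT : T ⊆ (P.addRed {e}).uncoloured G)
    (hreply : ∀ f ∈ (P.addRed {e}).uncoloured G, H.Adj e f → f ∈ T) :
    ((P.addRed {e}).addBlue T).Follows G H := by
  obtain ⟨heG, hered, heblue⟩ := Position.mem_uncoloured.1 he
  have hTred : Disjoint (P.red ∪ {e}) T :=
    Finset.disjoint_right.2 fun f hf => (Position.mem_uncoloured.1 (hT hf)).2.1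
  refine ⟨?_, ?_, ?_⟩ <;> simp only [Position.addRed, Position.addBlue, Finset.mem_union,
    Finset.mem_singleton]
  · rintro f (hf | rfl)
    exacts [hP.red_subset f hf, heG]
  · exact Finset.disjoint_union_right.2
      ⟨Finset.disjoint_union_left.2 ⟨hP.disjoint, Finset.disjoint_singleton_left.2 heblue⟩, hTred⟩
  · rintro f (hf | rfl) g hg hadj
    · exact Or.inl (hP.mem_blue f hf g hg hadj)
    · have hgred : g ∉ P.red := fun h => heblue (hP.mem_blue g h f heG hadj.symm)
      refine or_iff_not_imp_left.2 fun hgblue => hreply g (Position.mem_uncoloured.2 ?_) hadj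
      simp [Position.addRed, hg, hgred, hgblue, hadj.ne']

theorem Position.Follows.exists_reply {H : SimpleGraph (Sym2 V)} {P : Position V}
    (hP : P.Follows G H) {e : Sym2 V} (he : e ∈ P.uncoloured G)
    (hdeg : (H.neighborSet e).encard ≤ q) :
    ∃ T, (P.addRed {e}).IsMove G q T ∧ ((P.addRed {e}).addBlue T).Follows G H := by
  classical
  set U := (P.addRed {e}).uncoloured G
  have hcard : ({f ∈ U | H.Adj e f} : Finset _).card ≤ q := by
    have hsub : (({f ∈ U | H.Adj e f} : Finset _) : Set (Sym2 V)) ⊆ H.neighborSet e :=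
      fun f hf => (Finset.mem_filter.1 hf).2
    exact_mod_cast (Set.encard_coe_eq_coe_finsetCard _).ge.trans
      ((Set.encard_le_encard hsub).trans hdeg)
  obtain ⟨T, hNT, hTU, hTcard⟩ := Finset.exists_subsuperset_card_eq (Finset.filter_subset _ U)
    (le_min hcard (Finset.card_filter_le _ _)) (min_le_right _ _)
  exact ⟨T, ⟨hTU, hTcard⟩, hP.addRed_addBlue he hTU
    fun f hf hadj => hNT (Finset.mem_filter.2 ⟨hf, hadj⟩)⟩

theorem Position.Follows.scoreAlice_lt_scoreBob [Finite V] {H : SimpleGraph (Sym2 V)}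
    {P : Position V} (hP : P.Follows G H) (hover : P.IsOver G) {e : Sym2 V} (he : e ∈ P.red)
    (hwin : ∀ R ≤ G, e ∈ R.edgeSet → H.IsIndepSet R.edgeSet →
      R.cliqueNum < (G \ R).cliqueNum) : P.scoreAlice < P.scoreBob := by
  set R := SimpleGraph.fromEdgeSet (P.red : Set (Sym2 V))
  have hedge : R.edgeSet ⊆ P.red := by
    rw [SimpleGraph.edgeSet_fromEdgeSet]
    exact Set.sdiff_subset
  have hle : R ≤ G := (SimpleGraph.fromEdgeSet_le G).2 fun f hf => hP.red_subset f hf.1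
  have heR : e ∈ R.edgeSet := by
    rw [SimpleGraph.edgeSet_fromEdgeSet]
    exact ⟨he, G.not_isDiag_of_mem_edgeSet (hP.red_subset e he)⟩
  calc R.cliqueNum < (G \ R).cliqueNum := hwin R hle heR (hP.isIndepSet.mono hedge)
    _ ≤ P.scoreBob :=
      cliqueNum_le_of_hom (SimpleGraph.Hom.ofLE (Position.sdiff_red_le_blue_of_isOver hover))

theorem wonByBob_of_forall_exists_conflictGraph [Finite V] (hG : G.edgeSet.Nonempty)
    (h : ∀ e ∈ G.edgeSet, ∃ H : SimpleGraph (Sym2 V), (∀ f, (H.neighborSet f).encard ≤ q) ∧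
      ∀ R ≤ G, e ∈ R.edgeSet → H.IsIndepSet R.edgeSet → R.cliqueNum < (G \ R).cliqueNum) :
    WonByBob G 1 q := by
  choose! H hdeg hwin using h
  refine wonByBob_of_invariant
    (fun P => P = Position.start V ∨ ∃ e ∈ P.red, P.Follows G (H e)) (Or.inl rfl) ?_ ?_
  · intro P S hP hover hS
    have hpos : 1 ≤ (P.uncoloured G).card :=
      Finset.card_pos.2 (Finset.nonempty_iff_ne_empty.2 hover)
    obtain ⟨e, rfl⟩ := Finset.card_eq_one.1 (hS.2.trans (min_eq_left hpos))
    have he : e ∈ P.uncoloured G := hS.1 (Finset.mem_singleton_self e)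
    rcases hP with rfl | ⟨e₀, he₀, hP⟩
    · have heG := (Position.mem_uncoloured.1 he).1
      obtain ⟨T, hT, hTfollows⟩ := (Position.follows_start (H e)).exists_reply he (hdeg e heG e)
      exact ⟨T, hT, Or.inr ⟨e, Finset.mem_union_right _ (Finset.mem_singleton_self e), hTfollows⟩⟩
    · obtain ⟨T, hT, hTfollows⟩ := hP.exists_reply he (hdeg e₀ (hP.red_subset e₀ he₀) e)
      exact ⟨T, hT, Or.inr ⟨e₀, Finset.mem_union_left _ he₀, hTfollows⟩⟩
  · rintro P (rfl | ⟨e, he, hP⟩) hover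
    · obtain ⟨e, he⟩ := hG
      have huncoloured : e ∈ (Position.start V).uncoloured G := by
        simp [Position.mem_uncoloured, Position.start, he]
      exact absurd hover (Finset.ne_empty_of_mem huncoloured)
    · exact hP.scoreAlice_lt_scoreBob hover he (hwin e (hP.red_subset e he))

end Strategies

section CompleteBoards

variable {V W : Type*}

theorem exists_equiv_map_eq (φ : V ≃ W) {e : Sym2 V} (he : ¬ e.IsDiag) {f : Sym2 W}
    (hf : ¬ f.IsDiag) : ∃ ψ : V ≃ W, e.map ψ = f := by
  induction e with | _ a b
  induction f with | _ x y
  obtain ⟨σ, hσ⟩ := Equiv.Perm.exists_extending_pair ![φ a, φ b] ![x, y]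
    (by simpa [Function.Injective, Fin.forall_fin_two, eq_comm (a := b)] using he)
    (by simpa [Function.Injective, Fin.forall_fin_two, eq_comm (a := y)] using hf)
  exact ⟨φ.trans σ, by simpa using congr_arg₂ Sym2.mk (hσ 0) (hσ 1)⟩

theorem wonByBob_top_of_forall_cliqueNum_lt_indepNum [DecidableEq V] [Finite V]
    [Fintype (⊤ : SimpleGraph V).edgeSet] {q : ℕ} (φ : V ≃ W) {x y : W} (hxy : x ≠ y)
    {H : SimpleGraph (Sym2 W)} (hdeg : ∀ f, (H.neighborSet f).encard ≤ q)
    (hwin : ∀ R : SimpleGraph W, R.Adj x y → H.IsIndepSet R.edgeSet →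
      R.cliqueNum < R.indepNum) : WonByBob (⊤ : SimpleGraph V) 1 q := by
  refine wonByBob_of_forall_exists_conflictGraph
    ⟨s(φ.symm x, φ.symm y), by simpa using hxy⟩ fun e he => ?_
  obtain ⟨ψ, hψ⟩ := exists_equiv_map_eq φ (SimpleGraph.not_isDiag_of_mem_edgeSet _ he)
    (f := s(x, y)) hxy
  refine ⟨H.comap (Sym2.map ψ), fun f => ?_, fun R _ heR hR => ?_⟩
  · exact (Set.encard_le_encard_of_injOn (f := Sym2.map ψ) (fun _ hg => hg)
      (Sym2.map.injective ψ.injective).injOn).trans (hdeg (f.map ψ))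
  have : Finite W := .of_equiv V ψ
  let R' : SimpleGraph W := R.comap ψ.symm
  let ρ : R' ≃g R := SimpleGraph.Iso.comap ψ.symm R
  have hxyR : R'.Adj x y := by
    have hmap : s(ψ.symm x, ψ.symm y) = e := by
      rw [← Sym2.map_mk, ← hψ, Sym2.map_map, ψ.symm_comp_self, Sym2.map_id, id]
    rwa [SimpleGraph.comap_adj, ← SimpleGraph.mem_edgeSet, hmap]
  have hR' : H.IsIndepSet R'.edgeSet := by
    have hcancel (f : Sym2 W) : (f.map ψ.symm).map ψ = f := by
      rw [Sym2.map_map, ψ.self_comp_symm, Sym2.map_id, id]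
    have hmem {f : Sym2 W} (hf : f ∈ R'.edgeSet) : f.map ψ.symm ∈ R.edgeSet :=
      ρ.toHom.map_mem_edgeSet hf
    intro f hf g hg hne hadj
    exact hR (hmem hf) (hmem hg) ((Sym2.map.injective ψ.symm.injective).ne hne)
      (by simpa only [SimpleGraph.comap_adj, hcancel] using hadj)
  calc R.cliqueNum ≤ R'.cliqueNum := cliqueNum_le_of_hom ρ.symm.toHom
    _ < R'.indepNum := hwin R' hxyR hR'
    _ = R'ᶜ.cliqueNum := R'.cliqueNum_compl.symm
    _ ≤ Rᶜ.cliqueNum := cliqueNum_le_of_hom ⟨ψ.symm, by simp [R']⟩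
    _ = (⊤ \ R).cliqueNum := by rw [top_sdiff]

end CompleteBoards

/-- A core: the part `S` of a complete board on which Bob does not pair vertices. Outside the core,
the vertices come in pairs `v`, `v'`; Bob answers `sv` by the edges `tv'` with `t ∈ link s`, and
`vv'` by the edges from `apex` to `v` and `v'`. Inside the core he follows the graph `conflict`, and
`fst` and `snd` are the ends of Alice's first edge. -/
structure Core (S : Type*) where
  link : S → Finset S
  apex : S
  conflict : SimpleGraph (Sym2 S)
  fst : S
  snd : S
  fst_ne_snd : fst ≠ snd
  link_symm : ∀ s t, t ∈ link s → s ∈ link t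
  mem_link_self : ∀ s, s ≠ apex → s ∈ link s
  card_link_le : ∀ s, (link s).card ≤ 3
  card_link_apex_le : (link apex).card ≤ 2
  encard_neighborSet_conflict_le : ∀ e, (conflict.neighborSet e).encard ≤ 3
  exists_isIndepSet : ∀ R : SimpleGraph S, R.Adj fst snd → conflict.IsIndepSet R.edgeSet →
    ∀ D : Finset S, D.Nonempty → R.IsClique D →
      ∃ I : Finset S, R.IsIndepSet I ∧ D.card < I.card ∧ ∀ t ∈ I, ∃ s ∈ D, t ∈ link s

namespace Core

variable {S ι : Type*} (K : Core S)

/-- The conflicts between the edges of a board consisting of a core and pairs of vertices, where the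
vertices `(i, true)` and `(i, false)` form a pair. The relation is neither symmetric nor
irreflexive: `conflictGraph` takes care of both. -/
inductive Conflict : Sym2 (S ⊕ ι × Bool) → Sym2 (S ⊕ ι × Bool) → Prop
  | core {s t s' t' : S} : K.conflict.Adj s(s, t) s(s', t') →
      Conflict s(.inl s, .inl t) s(.inl s', .inl t')
  | link {s t : S} (i : ι) (b : Bool) : t ∈ K.link s →
      Conflict s(.inl s, .inr (i, b)) s(.inl t, .inr (i, !b))
  | apex (i : ι) (b : Bool) :
      Conflict s(.inr (i, true), .inr (i, false)) s(.inl K.apex, .inr (i, b))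
  | cross {i j : ι} (b c b' c' : Bool) : i ≠ j →
      Conflict s(.inr (i, b), .inr (j, c)) s(.inr (i, b'), .inr (j, c'))

/-- The conflict graph that Bob follows on a board consisting of a core and pairs of vertices. -/
def conflictGraph : SimpleGraph (Sym2 (S ⊕ ι × Bool)) :=
  SimpleGraph.fromRel K.Conflict

section Degree

theorem neighborSet_conflictGraph_inl_inl_subset (s t : S) :
    (K.conflictGraph (ι := ι)).neighborSet s(.inl s, .inl t) ⊆
      Sym2.map .inl '' K.conflict.neighborSet s(s, t) := by
  rintro f ⟨-, h | h⟩ <;> generalize he : s(Sum.inl s, Sum.inl t) = e at h <;> cases h <;>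
    simp only [Sym2.eq_iff, Sum.inl.injEq, reduceCtorEq, and_false, false_and, or_self] at he <;>
    rw [← Sym2.eq_iff] at he
  case inl.core s' t' h => exact ⟨s(s', t'), by rwa [he], rfl⟩
  case inr.core s' t' _ _ h => exact ⟨s(s', t'), by rw [he]; exact h.symm, rfl⟩

theorem neighborSet_conflictGraph_inl_inr_subset (s : S) (i : ι) (b : Bool) :
    K.conflictGraph.neighborSet s(.inl s, .inr (i, b)) ⊆
      (fun t => s(.inl t, .inr (i, !b))) '' K.link s ∪
        {f | s = K.apex ∧ f = s(.inr (i, true), .inr (i, false))} := by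
  rintro f ⟨-, h | h⟩ <;> generalize he : s(Sum.inl s, Sum.inr (i, b)) = e at h <;> cases h <;>
    simp only [Sym2.eq_iff, Sum.inl.injEq, Sum.inr.injEq, Prod.mk.injEq, reduceCtorEq, and_false,
      false_and, or_false, or_self] at he
  case inl.link s t j c h =>
    obtain ⟨rfl, rfl, rfl⟩ := he
    exact .inl ⟨t, h, rfl⟩
  case inr.link t s j c h =>
    obtain ⟨rfl, rfl, rfl⟩ := he
    exact .inl ⟨t, K.link_symm _ _ h, by rw [Bool.not_not]⟩
  case inr.apex j c =>
    obtain ⟨rfl, rfl, rfl⟩ := he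
    exact .inr ⟨rfl, rfl⟩

theorem neighborSet_conflictGraph_inr_inr_self_subset (i : ι) (b c : Bool) :
    K.conflictGraph.neighborSet s(.inr (i, b), .inr (i, c)) ⊆
      Set.range fun d : Bool => s(.inl K.apex, .inr (i, d)) := by
  rintro f ⟨-, h | h⟩ <;> generalize he : s(Sum.inr (i, b), Sum.inr (i, c)) = e at h <;>
    cases h <;> simp only [Sym2.eq_iff, Sum.inr.injEq, Prod.mk.injEq, reduceCtorEq, and_false,
      false_and, or_self] at he
  case inl.apex j d =>
    obtain rfl : i = j := he.elim (fun h => h.1.1) fun h => h.1.1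
    exact ⟨d, rfl⟩
  all_goals grind

theorem neighborSet_conflictGraph_inr_inr_subset {i j : ι} (hij : i ≠ j) (b c : Bool) :
    K.conflictGraph.neighborSet s(.inr (i, b), .inr (j, c)) ⊆
      (fun d : Bool × Bool => s(.inr (i, d.1), .inr (j, d.2))) '' {(b, c)}ᶜ := by
  rintro f ⟨hne, h⟩
  suffices ∃ b' c', s(.inr (i, b'), .inr (j, c')) = f by
    obtain ⟨b', c', rfl⟩ := this
    exact ⟨(b', c'), by rintro ⟨⟩; exact hne rfl, rfl⟩
  rcases h with h | h <;> generalize he : s(Sum.inr (i, b), Sum.inr (j, c)) = e at h <;>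
    cases h <;> simp only [Sym2.eq_iff, Sum.inr.injEq, Prod.mk.injEq, reduceCtorEq, and_false,
      false_and, or_self] at he
  case inl.apex => grind
  case inl.cross b' c' _ =>
    rcases he with ⟨⟨rfl, -⟩, rfl, -⟩ | ⟨⟨rfl, -⟩, rfl, -⟩
    exacts [⟨b', c', rfl⟩, ⟨c', b', Sym2.eq_swap⟩]
  case inr.cross b' c' _ _ _ =>
    rcases he with ⟨⟨rfl, -⟩, rfl, -⟩ | ⟨⟨rfl, -⟩, rfl, -⟩
    exacts [⟨b', c', rfl⟩, ⟨c', b', Sym2.eq_swap⟩]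

theorem encard_neighborSet_conflictGraph_inl_inr_le (s : S) (i : ι) (b : Bool) :
    (K.conflictGraph.neighborSet s(.inl s, .inr (i, b))).encard ≤ 3 := by
  refine (Set.encard_le_encard (K.neighborSet_conflictGraph_inl_inr_subset s i b)).trans ?_
  have hlink (n : ℕ) (hn : (K.link s).card ≤ n) :
      ((fun t => s(Sum.inl t, Sum.inr (i, !b))) '' (K.link s : Set S)).encard ≤ n :=
    calc _ ≤ (K.link s : Set S).encard := Set.encard_image_le _ _
      _ ≤ n := by rw [Set.encard_coe_eq_coe_finsetCard]; exact_mod_cast hn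
  by_cases hs : s = K.apex
  · calc _ ≤ (2 : ℕ∞) + 1 := (Set.encard_union_le _ _).trans
          (add_le_add (hlink 2 (hs ▸ K.card_link_apex_le)) (by simp [hs]))
      _ = 3 := rfl
  · simpa [hs] using hlink 3 (K.card_link_le s)

theorem encard_neighborSet_conflictGraph_inr_inr_le (i j : ι) (b c : Bool) :
    (K.conflictGraph.neighborSet s(.inr (i, b), .inr (j, c))).encard ≤ 3 := by
  by_cases hij : i = j
  · subst hij
    calc _ ≤ (Set.range fun d : Bool => s(Sum.inl K.apex, Sum.inr (i, d))).encard :=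
          Set.encard_le_encard (K.neighborSet_conflictGraph_inr_inr_self_subset i b c)
      _ ≤ (Set.univ : Set Bool).encard := Set.image_univ (α := Bool) ▸ Set.encard_image_le _ _
      _ = 2 := by rw [Set.encard_univ, ENat.card_eq_coe_fintype_card]; rfl
      _ ≤ 3 := by decide
  · calc _ ≤ ({(b, c)}ᶜ : Set (Bool × Bool)).encard :=
          (Set.encard_le_encard (K.neighborSet_conflictGraph_inr_inr_subset hij b c)).trans
            (Set.encard_image_le _ _)
      _ = 3 := by
        rw [Set.encard_eq_coe_toFinset_card]
        revert b c
        decide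

theorem encard_neighborSet_conflictGraph_le (e : Sym2 (S ⊕ ι × Bool)) :
    (K.conflictGraph.neighborSet e).encard ≤ 3 := by
  induction e with | _ x y
  rcases x with s | ⟨i, b⟩ <;> rcases y with t | ⟨j, c⟩
  · exact (Set.encard_le_encard (K.neighborSet_conflictGraph_inl_inl_subset s t)).trans
      ((Set.encard_image_le _ _).trans (K.encard_neighborSet_conflict_le _))
  · exact K.encard_neighborSet_conflictGraph_inl_inr_le s j c
  · rw [Sym2.eq_swap]
    exact K.encard_neighborSet_conflictGraph_inl_inr_le t i b
  · exact K.encard_neighborSet_conflictGraph_inr_inr_le i j b c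

end Degree

section RedGraph

variable {K} {R : SimpleGraph (S ⊕ ι × Bool)}

theorem Conflict.not_adj {a b c d : S ⊕ ι × Bool} (h : K.Conflict s(a, b) s(c, d))
    (hne : s(a, b) ≠ s(c, d)) (hR : K.conflictGraph.IsIndepSet R.edgeSet) (hab : R.Adj a b) :
    ¬ R.Adj c d :=
  not_adj_of_isIndepSet_edgeSet hR ⟨hne, .inl h⟩ hab

variable (hR : K.conflictGraph.IsIndepSet R.edgeSet)
include hR

theorem not_adj_inl_inr_not {s t : S} {i : ι} {b : Bool} (ht : t ∈ K.link s)
    (h : R.Adj (.inl s) (.inr (i, b))) : ¬ R.Adj (.inl t) (.inr (i, !b)) :=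
  (Conflict.link i b ht).not_adj (by simp) hR h

theorem not_adj_apex {i : ι} {b : Bool} (h : R.Adj (.inr (i, b)) (.inr (i, !b))) (c : Bool) :
    ¬ R.Adj (.inl K.apex) (.inr (i, c)) := by
  have h : R.Adj (.inr (i, true)) (.inr (i, false)) := by
    cases b
    exacts [h.symm, h]
  exact (Conflict.apex i c).not_adj (by simp) hR h

theorem not_adj_inr_inr {i j : ι} (hij : i ≠ j) {b c b' c' : Bool} (hne : (b, c) ≠ (b', c'))
    (h : R.Adj (.inr (i, b)) (.inr (j, c))) : ¬ R.Adj (.inr (i, b')) (.inr (j, c')) :=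
  (Conflict.cross b c b' c' hij).not_adj (by simpa [hij] using hne) hR h

theorem isIndepSet_edgeSet_comap_inl : K.conflict.IsIndepSet (R.comap Sum.inl).edgeSet := by
  intro e he f hf hne hadj
  induction e with | _ a b
  induction f with | _ c d
  exact (Conflict.core hadj).not_adj ((Sym2.map.injective Sum.inl_injective).ne hne) hR he hf

theorem subset_pair_of_isClique [DecidableEq S] [DecidableEq ι] {C : Finset (S ⊕ ι × Bool)}
    (hC : R.IsClique C) {i : ι} {b : Bool} (hb : .inr (i, b) ∈ C) (hb' : .inr (i, !b) ∈ C) :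
    C ⊆ {.inr (i, b), .inr (i, !b)} := by
  have hpair : R.Adj (.inr (i, b)) (.inr (i, !b)) := hC hb hb' (by simp)
  rintro (s | ⟨j, c⟩) hx
  · have hsb : R.Adj (.inl s) (.inr (i, b)) := hC hx hb (by simp)
    have hsb' : R.Adj (.inl s) (.inr (i, !b)) := hC hx hb' (by simp)
    by_cases hs : s = K.apex
    · exact absurd (hs ▸ hsb) (not_adj_apex hR hpair b)
    · exact absurd hsb' (not_adj_inl_inr_not hR (K.mem_link_self s hs) hsb)
  · by_cases hij : i = j
    · subst hij
      cases b <;> cases c <;> simp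
    · have hbc : R.Adj (.inr (i, b)) (.inr (j, c)) := hC hb hx (by simp [hij])
      have hbc' : R.Adj (.inr (i, !b)) (.inr (j, c)) := hC hb' hx (by simp [hij])
      exact absurd hbc' (not_adj_inr_inr hR hij (by simp) hbc)

theorem exists_isIndepSet_inl (hfirst : R.Adj (.inl K.fst) (.inl K.snd))
    {C : Finset (S ⊕ ι × Bool)} (hC : R.IsClique C) (hne : C.toLeft.Nonempty) :
    ∃ X : Finset (S ⊕ ι × Bool), R.IsIndepSet X ∧ C.toLeft.card < X.card ∧
      ∀ x ∈ X, ∃ s t, .inl s ∈ C ∧ t ∈ K.link s ∧ x = .inl t := by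
  have hcore : (R.comap Sum.inl).IsClique (C.toLeft : Set S) := fun s hs t ht hst =>
    hC (Finset.mem_toLeft.1 hs) (Finset.mem_toLeft.1 ht) (Sum.inl_injective.ne hst)
  obtain ⟨I, hI, hcard, hlink⟩ :=
    K.exists_isIndepSet _ hfirst (isIndepSet_edgeSet_comap_inl hR) _ hne hcore
  refine ⟨I.map .inl, ?_, by rwa [Finset.card_map], ?_⟩
  · rw [Finset.coe_map]
    rintro _ ⟨s, hs, rfl⟩ _ ⟨t, ht, rfl⟩ hst
    exact hI hs ht (ne_of_apply_ne _ hst)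
  · intro x hx
    obtain ⟨t, ht, rfl⟩ := Finset.mem_map.1 hx
    obtain ⟨s, hs, hst⟩ := hlink t ht
    exact ⟨s, t, Finset.mem_toLeft.1 hs, hst, rfl⟩

end RedGraph

section Mirror

/-- The partners of the vertices of `C` that lie outside the core. -/
def mirror (C : Finset (S ⊕ ι × Bool)) : Finset (S ⊕ ι × Bool) :=
  C.toRight.map ((Equiv.prodCongr (.refl ι) Equiv.boolNot).toEmbedding.trans .inr)

theorem mem_mirror {C : Finset (S ⊕ ι × Bool)} {x : S ⊕ ι × Bool} :
    x ∈ mirror C ↔ ∃ i b, .inr (i, b) ∈ C ∧ x = .inr (i, !b) := by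
  simp [mirror, eq_comm (a := x)]

theorem card_mirror (C : Finset (S ⊕ ι × Bool)) : (mirror C).card = C.toRight.card :=
  Finset.card_map _

variable {K} {R : SimpleGraph (S ⊕ ι × Bool)} {C : Finset (S ⊕ ι × Bool)}

theorem isIndepSet_mirror (hR : K.conflictGraph.IsIndepSet R.edgeSet) (hC : R.IsClique C)
    (hpairs : ∀ i b, .inr (i, b) ∈ C → .inr (i, !b) ∉ C) : R.IsIndepSet (mirror C) := by
  intro x hx y hy hxy
  obtain ⟨i, b, hb, rfl⟩ := mem_mirror.1 hx
  obtain ⟨j, c, hc, rfl⟩ := mem_mirror.1 hy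
  have hij : i ≠ j := by
    rintro rfl
    obtain rfl : c = !b := by simpa [Bool.eq_not_iff, eq_comm] using hxy
    exact hpairs i b hb hc
  exact not_adj_inr_inr hR hij (by simp) (hC hb hc (by simp [hij]))

theorem exists_isIndepSet_card_lt_of_disjoint_mirror
    (hR : K.conflictGraph.IsIndepSet R.edgeSet) (hC : R.IsClique C)
    (hpairs : ∀ i b, .inr (i, b) ∈ C → .inr (i, !b) ∉ C) {X : Finset (S ⊕ ι × Bool)}
    (hX : R.IsIndepSet X) (hcard : C.toLeft.card < X.card) (hdisj : Disjoint X (mirror C))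
    (hadj : ∀ x ∈ X, ∀ y ∈ mirror C, ¬ R.Adj x y) :
    ∃ B : Finset (S ⊕ ι × Bool), R.IsIndepSet B ∧ C.card < B.card := by
  refine ⟨X.disjUnion _ hdisj, ?_, ?_⟩
  · rw [Finset.coe_disjUnion]
    exact Set.pairwise_union.2 ⟨hX, isIndepSet_mirror hR hC hpairs, 
      fun x hx y hy _ => ⟨hadj x hx y hy, fun h => hadj x hx y hy h.symm⟩⟩
  · rw [Finset.card_disjUnion, card_mirror, ← Finset.card_toLeft_add_card_toRight]
    exact Nat.add_lt_add_right hcard _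

end Mirror

section Winning

variable {K} {R : SimpleGraph (S ⊕ ι × Bool)} {C : Finset (S ⊕ ι × Bool)}
  (hR : K.conflictGraph.IsIndepSet R.edgeSet) (hC : R.IsClique C)
include hR hC

theorem exists_isIndepSet_card_lt_of_toLeft_nonempty (hfirst : R.Adj (.inl K.fst) (.inl K.snd))
    (hpairs : ∀ i b, .inr (i, b) ∈ C → .inr (i, !b) ∉ C) (hcore : C.toLeft.Nonempty) :
    ∃ B : Finset (S ⊕ ι × Bool), R.IsIndepSet B ∧ C.card < B.card := by
  obtain ⟨X, hX, hcard, hlink⟩ := exists_isIndepSet_inl hR hfirst hC hcore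
  refine exists_isIndepSet_card_lt_of_disjoint_mirror hR hC hpairs hX hcard
    (Finset.disjoint_left.2 fun x hx hxC => ?_) fun x hx y hy => ?_
  · obtain ⟨s, t, -, -, rfl⟩ := hlink x hx
    simp [mem_mirror] at hxC
  · obtain ⟨s, t, hs, hst, rfl⟩ := hlink x hx
    obtain ⟨i, b, hb, rfl⟩ := mem_mirror.1 hy
    exact not_adj_inl_inr_not hR hst (hC hs hb (by simp))

theorem exists_isIndepSet_card_lt_of_toLeft_eq_empty
    (hpairs : ∀ i b, .inr (i, b) ∈ C → .inr (i, !b) ∉ C) (hcore : C.toLeft = ∅) :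
    ∃ B : Finset (S ⊕ ι × Bool), R.IsIndepSet B ∧ C.card < B.card := by
  by_cases hblue : ∃ i b, .inr (i, b) ∈ C ∧ ¬ R.Adj (.inr (i, b)) (.inr (i, !b))
  · obtain ⟨i, b, hb, hadj⟩ := hblue
    refine exists_isIndepSet_card_lt_of_disjoint_mirror hR hC hpairs (X := {.inr (i, b)})
      (by simp) (by simp [hcore]) (Finset.disjoint_singleton_left.2 fun hmem => ?_) ?_
    · obtain ⟨j, c, hc, hbc⟩ := mem_mirror.1 hmem
      obtain ⟨rfl, rfl⟩ : i = j ∧ b = !c := by simpa using hbc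
      exact hpairs i c hc hb
    · simp only [Finset.mem_singleton, forall_eq, mem_mirror]
      rintro _ ⟨j, c, hc, rfl⟩
      by_cases hij : i = j
      · subst hij
        obtain rfl : c = b := by
          by_contra hne
          exact hpairs i b hb (Bool.eq_not_iff.2 hne ▸ hc)
        exact hadj
      · exact not_adj_inr_inr hR hij (by simp) (hC hb hc (by simp [hij]))
  · push Not at hblue
    refine exists_isIndepSet_card_lt_of_disjoint_mirror hR hC hpairs (X := {.inl K.apex})
      (by simp) (by simp [hcore]) (Finset.disjoint_singleton_left.2 (by simp [mem_mirror])) ?_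
    simp only [Finset.mem_singleton, forall_eq, mem_mirror]
    rintro _ ⟨i, b, hb, rfl⟩
    exact not_adj_apex hR (hblue i b hb) _

theorem exists_isIndepSet_card_lt (hfirst : R.Adj (.inl K.fst) (.inl K.snd)) :
    ∃ B : Finset (S ⊕ ι × Bool), R.IsIndepSet B ∧ C.card < B.card := by
  classical
  by_cases hpairs : ∀ i b, .inr (i, b) ∈ C → .inr (i, !b) ∉ C
  · rcases C.toLeft.eq_empty_or_nonempty with hcore | hcore
    · exact exists_isIndepSet_card_lt_of_toLeft_eq_empty hR hC hpairs hcore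
    · exact exists_isIndepSet_card_lt_of_toLeft_nonempty hR hC hfirst hpairs hcore
  · push Not at hpairs
    obtain ⟨i, b, hb, hb'⟩ := hpairs
    have hedge : R.IsClique ({.inl K.fst, .inl K.snd} : Finset (S ⊕ ι × Bool)) := by
      simpa using fun _ => hfirst
    obtain ⟨B, hB, hcard, -⟩ := exists_isIndepSet_inl hR hfirst hedge ⟨K.fst, by simp⟩
    have htoLeft :
        ({.inl K.fst, .inl K.snd} : Finset (S ⊕ ι × Bool)).toLeft = {K.fst, K.snd} := by
      ext; simp
    refine ⟨B, hB, ?_⟩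
    calc C.card ≤ 2 := (Finset.card_le_card (subset_pair_of_isClique hR hC hb hb')).trans
          Finset.card_le_two
      _ < B.card := by rwa [htoLeft, Finset.card_pair K.fst_ne_snd] at hcard

omit hC in
theorem cliqueNum_lt_indepNum [Finite S] [Finite ι] (hfirst : R.Adj (.inl K.fst) (.inl K.snd)) :
    R.cliqueNum < R.indepNum := by
  obtain ⟨C, hC⟩ := R.exists_isNClique_cliqueNum
  obtain ⟨B, hB, hcard⟩ := exists_isIndepSet_card_lt hR hC.isClique hfirst
  exact hC.card_eq ▸ hcard.trans_le hB.card_le_indepNum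

end Winning

theorem wonByBob (K : Core S) {V : Type*} [DecidableEq V] [Finite V]
    [Fintype (⊤ : SimpleGraph V).edgeSet] (φ : V ≃ S ⊕ ι × Bool) {q : ℕ} (hq : 3 ≤ q) :
    WonByBob (⊤ : SimpleGraph V) 1 q := by
  have : Finite (S ⊕ ι × Bool) := .of_equiv V φ
  have : Finite S := .of_injective (Sum.inl : S → S ⊕ ι × Bool) Sum.inl_injective
  have : Finite ι := .of_injective (fun i => (.inr (i, true) : S ⊕ ι × Bool)) fun i j => by simp
  exact wonByBob_top_of_forall_cliqueNum_lt_indepNum φ (Sum.inl_injective.ne K.fst_ne_snd)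
    (fun f => (K.encard_neighborSet_conflictGraph_le f).trans (by exact_mod_cast hq))
    fun R hfirst hR => cliqueNum_lt_indepNum hR hfirst

end Core

section Cores

theorem exists_isIndepSet_of_cliqueFree_three {S : Type*} [DecidableEq S] {R : SimpleGraph S}
    {L : S → Finset S} (hfree : R.CliqueFree 3) (hone : ∀ s, ∃ I ⊆ L s, R.IsNIndepSet 2 I)
    (htwo : ∀ s t, R.Adj s t → ∃ I ⊆ L s ∪ L t, R.IsNIndepSet 3 I) (D : Finset S)
    (hne : D.Nonempty) (hD : R.IsClique D) :
    ∃ I : Finset S, R.IsIndepSet I ∧ D.card < I.card ∧ ∀ t ∈ I, ∃ s ∈ D, t ∈ L s := by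
  have hpos := hne.card_pos
  have hlt : D.card < 3 := not_le.1 fun h => hfree.mono h D ⟨hD, rfl⟩
  obtain hcard | hcard : D.card = 1 ∨ D.card = 2 := by lia
  · obtain ⟨s, rfl⟩ := Finset.card_eq_one.1 hcard
    obtain ⟨I, hIs, hI⟩ := hone s
    exact ⟨I, hI.isIndepSet, by simp [hI.card_eq], fun t ht => ⟨s, by simp, hIs ht⟩⟩
  · obtain ⟨s, t, hst, rfl⟩ := Finset.card_eq_two.1 hcard
    obtain ⟨I, hIst, hI⟩ := htwo s t (hD (by simp) (by simp) hst)
    exact ⟨I, hI.isIndepSet, by simp [hcard, hI.card_eq],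
      fun u hu => by simpa using hIst hu⟩

/-- The links of `coreFour`: each of them contains two of the vertices `0`, `2`, `3`, and the links
of `1` and of any other vertex contain together all three. -/
def linkFour : Fin 4 → Finset (Fin 4) :=
  ![{0, 2, 3}, {2, 3}, {0, 1, 2}, {0, 1, 3}]

/-- The conflicts of `coreFour`: when Alice starts with the edge `01`, Bob answers with the triangle
on `0`, `2`, `3`. -/
abbrev conflictFour : SimpleGraph (Sym2 (Fin 4)) :=
  SimpleGraph.fromRel fun e f =>
    (e, f) ∈ [(s(0, 1), s(0, 2)), (s(0, 1), s(0, 3)), (s(0, 1), s(2, 3))]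

theorem exists_isIndepSet_linkFour {R : SimpleGraph (Fin 4)} (hfirst : R.Adj 0 1)
    (hR : conflictFour.IsIndepSet R.edgeSet) (D : Finset (Fin 4)) (hne : D.Nonempty)
    (hD : R.IsClique D) :
    ∃ I : Finset _, R.IsIndepSet I ∧ D.card < I.card ∧ ∀ t ∈ I, ∃ s ∈ D, t ∈ linkFour s := by
  have htriangle : R.IsIndepSet ({0, 2, 3} : Finset (Fin 4)) :=
    isIndepSet_triple (not_adj_of_isIndepSet_edgeSet hR (by decide) hfirst)
      (not_adj_of_isIndepSet_edgeSet hR (by decide) hfirst)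
      (not_adj_of_isIndepSet_edgeSet hR (by decide) hfirst)
  refine exists_isIndepSet_of_cliqueFree_three (fun C hC => ?_) (fun s => ?_) (fun s t hst => ?_)
    D hne hD
  · have hle := card_inter_le_one_of_isClique_of_isIndepSet hC.isClique htriangle
    have hlt : ∀ C : Finset (Fin 4), C.card = 3 → 1 < (C ∩ {0, 2, 3}).card := by decide
    exact hle.not_gt (hlt C hC.card_eq)
  · obtain ⟨I, hsub, hcard, hI⟩ : ∃ I ⊆ linkFour s, I.card = 2 ∧ I ⊆ {0, 2, 3} := by
      decide +revert
    exact ⟨I, hsub, htriangle.mono hI, hcard⟩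
  · have hcover : ∀ s t : Fin 4, s ≠ t → ({s, t} : Finset (Fin 4)) ⊆ {0, 2, 3} ∨
        {0, 2, 3} ⊆ linkFour s ∪ linkFour t := by decide
    obtain hsub | hsub := hcover s t hst.ne
    · exact absurd hst (htriangle (hsub (by simp)) (hsub (by simp)) hst.ne)
    · exact ⟨_, hsub, htriangle, rfl⟩

/-- The core on four vertices, for boards with an even number of vertices. -/
def coreFour : Core (Fin 4) where
  link := linkFour
  apex := 1
  conflict := conflictFour
  fst := 0
  snd := 1
  fst_ne_snd := by decide
  link_symm := by decide
  mem_link_self := by decide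
  card_link_le := by decide
  card_link_apex_le := by decide
  encard_neighborSet_conflict_le e := by
    rw [encard_neighborSet_eq_degree]
    exact_mod_cast (by decide : ∀ e, conflictFour.degree e ≤ 3) e
  exists_isIndepSet _ := exists_isIndepSet_linkFour

/-- The links of `coreFive`: those of the ends of a red edge contain together all of `2`, `3`, `4`,
unless that edge is `03` or `13`. -/
def linkFive : Fin 5 → Finset (Fin 5) :=
  ![{2, 3}, {1, 3, 4}, {0, 2, 4}, {0, 1, 3}, {1, 2, 4}]

/-- The conflicts of `coreFive`: when Alice starts with the edge `01`, Bob answers with the triangle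
on `2`, `3`, `4`. The other conflicts keep `0` and `1` from having a common red neighbour, and put
the blue triangle `123` or `034` next to a red edge `03` or `13`. -/
abbrev conflictFive : SimpleGraph (Sym2 (Fin 5)) :=
  SimpleGraph.fromRel fun e f =>
    (e, f) ∈ [(s(0, 1), s(2, 3)), (s(0, 1), s(2, 4)), (s(0, 1), s(3, 4)),
      (s(0, 2), s(1, 2)), (s(0, 3), s(1, 3)), (s(0, 4), s(1, 4)),
      (s(0, 3), s(1, 2)), (s(1, 3), s(0, 4))]

section CoreFive

variable {R : SimpleGraph (Fin 5)} (hfirst : R.Adj 0 1)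
  (hR : conflictFive.IsIndepSet R.edgeSet)
include hR

theorem not_adj_one_of_adj_zero_of_conflictFive {c : Fin 5} (h : R.Adj 0 c) : ¬ R.Adj 1 c := by
  intro h'
  have hconflict : c ≠ 0 → c ≠ 1 → conflictFive.Adj s(0, c) s(1, c) := by
    clear h h'
    decide +revert
  exact not_adj_of_isIndepSet_edgeSet hR (hconflict h.ne' h'.ne') h h'

include hfirst

theorem isIndepSet_two_three_four_of_conflictFive : R.IsIndepSet ({2, 3, 4} : Finset (Fin 5)) :=
  isIndepSet_triple (not_adj_of_isIndepSet_edgeSet hR (by decide) hfirst)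
    (not_adj_of_isIndepSet_edgeSet hR (by decide) hfirst)
    (not_adj_of_isIndepSet_edgeSet hR (by decide) hfirst)

theorem cliqueFree_three_of_conflictFive : R.CliqueFree 3 := by
  intro C hC
  have hle := card_inter_le_one_of_isClique_of_isIndepSet hC.isClique
    (isIndepSet_two_three_four_of_conflictFive hfirst hR)
  have hmem : ∀ C : Finset (Fin 5), C.card = 3 → (C ∩ {2, 3, 4}).card ≤ 1 →
      0 ∈ C ∧ 1 ∈ C ∧ ∃ c ∈ C, c ≠ 0 ∧ c ≠ 1 := by decide
  obtain ⟨h0, h1, c, hc, hc0, hc1⟩ := hmem C hC.card_eq hle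
  exact not_adj_one_of_adj_zero_of_conflictFive hR (hC.isClique h0 hc hc0.symm)
    (hC.isClique h1 hc hc1.symm)

theorem exists_isNIndepSet_two_subset_linkFive (s : Fin 5) :
    ∃ I ⊆ linkFive s, R.IsNIndepSet 2 I := by
  by_cases hs : s = 3
  · subst hs
    by_cases h : R.Adj 0 3
    · have h' := not_adj_one_of_adj_zero_of_conflictFive hR h
      exact ⟨{1, 3}, by decide, isIndepSet_pair h', by decide⟩
    · exact ⟨{0, 3}, by decide, isIndepSet_pair h, by decide⟩
  · obtain ⟨I, hsub, hcard, hI⟩ : ∃ I ⊆ linkFive s, I.card = 2 ∧ I ⊆ {2, 3, 4} := by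
      decide +revert
    exact ⟨I, hsub, (isIndepSet_two_three_four_of_conflictFive hfirst hR).mono hI, hcard⟩

theorem exists_isNIndepSet_three_subset_linkFive {s t : Fin 5} (hst : R.Adj s t) :
    ∃ I ⊆ linkFive s ∪ linkFive t, R.IsNIndepSet 3 I := by
  have htriangle := isIndepSet_two_three_four_of_conflictFive hfirst hR
  have h23 : ¬ R.Adj 2 3 := htriangle (by simp) (by simp) (by decide)
  have h34 : ¬ R.Adj 3 4 := htriangle (by simp) (by simp) (by decide)
  have hcases : ∀ s t : Fin 5, s ≠ t → ({s, t} : Finset (Fin 5)) ⊆ {2, 3, 4} ∨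
      {2, 3, 4} ⊆ linkFive s ∪ linkFive t ∨
      s(s, t) = s(0, 3) ∧ {1, 2, 3} ⊆ linkFive s ∪ linkFive t ∨
      s(s, t) = s(1, 3) ∧ {0, 3, 4} ⊆ linkFive s ∪ linkFive t := by
    decide
  obtain hsub | hsub | ⟨he, hsub⟩ | ⟨he, hsub⟩ := hcases s t hst.ne
  · exact absurd hst (htriangle (hsub (by simp)) (hsub (by simp)) hst.ne)
  · exact ⟨_, hsub, htriangle, rfl⟩
  · have h03 : R.Adj 0 3 := by rwa [← SimpleGraph.mem_edgeSet, ← he]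
    exact ⟨_, hsub, isIndepSet_triple (not_adj_of_isIndepSet_edgeSet hR (by decide) h03)
      (not_adj_of_isIndepSet_edgeSet hR (by decide) h03) h23, rfl⟩
  · have h13 : R.Adj 1 3 := by rwa [← SimpleGraph.mem_edgeSet, ← he]
    exact ⟨_, hsub, isIndepSet_triple (not_adj_of_isIndepSet_edgeSet hR (by decide) h13)
      (not_adj_of_isIndepSet_edgeSet hR (by decide) h13) h34, rfl⟩

end CoreFive

/-- The core on five vertices, for boards with an odd number of vertices. -/
def coreFive : Core (Fin 5) where
  link := linkFive
  apex := 0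
  conflict := conflictFive
  fst := 0
  snd := 1
  fst_ne_snd := by decide
  link_symm := by decide
  mem_link_self := by decide
  card_link_le := by decide
  card_link_apex_le := by decide
  encard_neighborSet_conflict_le e := by
    rw [encard_neighborSet_eq_degree]
    exact_mod_cast (by decide : ∀ e, conflictFive.degree e ≤ 3) e
  exists_isIndepSet _ hfirst hR := exists_isIndepSet_of_cliqueFree_three
    (cliqueFree_three_of_conflictFive hfirst hR)
    (exists_isNIndepSet_two_subset_linkFive hfirst hR)
    fun _ _ => exists_isNIndepSet_three_subset_linkFive hfirst hR

end Cores

end CliqueGame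

theorem mainTheorem1_general {V : Type*} [Fintype V] [DecidableEq V]
    [Fintype (⊤ : SimpleGraph V).edgeSet] {q : ℕ} (hV : 4 ≤ Fintype.card V) (hq : 3 ≤ q) :
    CliqueGame.WonByBob (⊤ : SimpleGraph V) 1 q := by
  rcases Nat.even_or_odd' (Fintype.card V) with ⟨m, hm | hm⟩
  · exact CliqueGame.coreFour.wonByBob (ι := Fin (m - 2))
      (Fintype.equivOfCardEq (by simp; lia)) hq
  · exact CliqueGame.coreFive.wonByBob (ι := Fin (m - 2))
      (Fintype.equivOfCardEq (by simp; lia)) hq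

theorem mainTheorem1 (n : ℕ) (hn : 4 ≤ n) :
    CliqueGame.WonByBob (⊤ : SimpleGraph (Fin n)) 1 3 :=
  mainTheorem1_general (by rwa [Fintype.card_fin]) le_rfl
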